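/- Let $\mathcal D$ be a set. A plane rooted tree decorated by $\mathcal D$ is a finite rooted tree in which the children of every vertex are linearly ordered (from left to right) and every vertex carries an element of $\mathcal D$; let $\mathcal T$ be the set of these trees. A forest is a finite, possibly empty sequence $F=t_1\cdots t_n$ of such trees; let $\mathcal F$ be the set of forests, and let the weight of a forest be its number of vertices. Let $\mathcal H=\mathcal H^{\mathcal D}_{P,R}$ be the free associative unital $\mathbb Q$-algebra on $\mathcal T$; the forests are its monomials, hence a $\mathbb Q$-basis, with the empty forest equal to $1$, and $\mathcal H$ is graded by the weight. An admissible cut $c$ of a tree $t$ is either the total cut, with $P^c(t)=t$ and $R^c(t)=1$, or a (possibly empty) set of edges of $t$ such that every path going upwards from the root contains at most one of them; in the latter case $R^c(t)$ is the component of the root after the edges of $c$ are removed and $P^c(t)$ is the forest of the other components, from left to right. An admissible cut of a forest $F=t_1\cdots t_n$ is a tuple $c=(c_1,\dots,c_n)$ of admissible cuts $c_i$ of $t_i$, with $P^c(F)=P^{c_1}(t_1)\cdots P^{c_n}(t_n)$ and $R^c(F)=R^{c_1}(t_1)\cdots R^{c_n}(t_n)$. With the coproduct $\Delta(F)=\sum_c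 P^c(F)\otimes R^c(F)$, the sum being over all admissible cuts of $F$, and the counit $\varepsilon(1)=1$, $\varepsilon(F)=0$ for $F\neq1$, the algebra $\mathcal H$ is a graded Hopf algebra; let $S$ be its antipode and $\mathrm{Prim}(\mathcal H)=\{x:\Delta(x)=x\otimes1+1\otimes x\}$. For $d\in\mathcal D$ let $B_d^+$ be the linear endomorphism of $\mathcal H$ that sends a forest $t_1\cdots t_n$ to the tree obtained by grafting $t_1,\dots,t_n$, in this order, on a common root decorated by $d$, and let $\gamma_d$ be the linear endomorphism of $\mathcal H$ that sends $t_1\cdots t_n$ to $t_1\cdots t_{n-1}$ if $n\ge1$ and $t_n$ is the one-vertex tree decorated by $d$, and sends every other forest (including $1$) to $0$. Then there is a unique bilinear form $(\ ,\ )$ on $\mathcal H$ such that 1. $(1,x)=\varepsilon(x)$ for all $x\in\mathcal H$; 2. $(x_1x_2,y)=(x_1\otimes x_2,\Delta(y))$ for all $x_1,x_2,y\in\mathcal H$, where $(x_1\otimes x_2,y_1\otimes y_2)=(x_1,y_1)(x_2,y_2)$; 3. $(B_d^+(x),y)=(x,\gamma_d(y))$ for all $x,y\in\mathcal H$ and $d\in\mathcal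 D$. Moreover, this form satisfies: 4. $(x,y)=0$ if $x$ and $y$ are homogeneous of different weights; 5. $(\ ,\ )$ is symmetric and non-degenerate; 6. $(S(x),y)=(x,S(y))$ for all $x,y\in\mathcal H$; 7. there is a unique family $(e_F)_{F\in\mathcal F}$ in $\mathcal H$ with $(e_F,G)=\delta_{F,G}$ for all $F,G\in\mathcal F$, it is a basis of $\mathcal H$, and - a) $e_F$ is homogeneous of weight equal to the weight of $F$; - b) $(e_t)_{t\in\mathcal T}$ is a basis of $\mathrm{Prim}(\mathcal H)$; - c) for every forest $t_1\cdots t_n$, $\displaystyle\Delta(e_{t_1\cdots t_n})=\sum_{i=0}^n e_{t_1\cdots t_i}\otimes e_{t_{i+1}\cdots t_n}$. -/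

import Mathlib

open scoped TensorProduct

/-- Plane rooted trees whose vertices are decorated by `D`: a decorated root together with the
ordered list of the subtrees attached to it. -/
inductive PTree (D : Type*) : Type _
  | node : D → List (PTree D) → PTree D

/-- Plane rooted forests: finite sequences of plane rooted trees. -/
abbrev PForest (D : Type*) : Type _ := List (PTree D)

namespace PTree

variable {D : Type*}

theorem ind {p : PTree D → Prop} (h : ∀ d F, (∀ t ∈ F, p t) → p (node d F)) : ∀ t, p t
  | node d F => h d F (fun t _ => ind h t)

mutual
/-- The weight of a tree: its number of vertices. -/
def weight : PTree D → ℕ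
  | node _ F => forestWeight F + 1
/-- The weight of a forest: its number of vertices. -/
def forestWeight : List (PTree D) → ℕ
  | [] => 0
  | t :: F => weight t + forestWeight F
end

mutual
/-- All the markings of a tree by subsets of its vertex set (`true` means marked), each listed
once. Marking a vertex other than the root stands for cutting the edge that arrives at it, and
marking the root stands for cutting below the root, as the total cut does. -/
def markings : PTree D → List (PTree (D × Bool))
  | node d F =>
      (forestMarkings F).map (node (d, true)) ++ (forestMarkings F).map (node (d, false))
/-- All the markings of a forest by subsets of its vertex set, each listed once. -/
def forestMarkings : List (PTree D) → List (List (PTree (D × Bool)))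
  | [] => [[]]
  | t :: F => (markings t).flatMap fun t' => (forestMarkings F).map fun F' => t' :: F'
end

mutual
/-- The largest number of marked vertices on a path going up from the root. -/
def pathMarks : PTree (D × Bool) → ℕ
  | node (_, b) F => b.toNat + forestPathMarks F
/-- The largest number of marked vertices on a path going up from one of the roots. -/
def forestPathMarks : List (PTree (D × Bool)) → ℕ
  | [] => 0
  | t :: F => max (pathMarks t) (forestPathMarks F)
end

mutual
/-- Forget the marks. -/
def unmark : PTree (D × Bool) → PTree D
  | node (d, _) F => node d (forestUnmark F)
/-- Forget the marks. -/
def forestUnmark : List (PTree (D × Bool)) → List (PTree D)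
  | [] => []
  | t :: F => unmark t :: forestUnmark F
end

mutual
/-- The part `P^c(t)` of a cut tree: the plane forest of the components cut off, from left to
right. (It is used for admissible cuts only, where nothing above a marked vertex is marked.) -/
def pruned : PTree (D × Bool) → List (PTree D)
  | node (d, true) F => [unmark (node (d, true) F)]
  | node (_, false) F => forestPruned F
/-- The part `P^c(F)` of a cut forest. -/
def forestPruned : List (PTree (D × Bool)) → List (PTree D)
  | [] => []
  | t :: F => pruned t ++ forestPruned F
end

mutual
/-- The part `R^c(t)` of a cut tree: the component of the root, or the empty forest if the cut is
total. -/
def trunk : PTree (D × Bool) → List (PTree D)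
  | node (_, true) _ => []
  | node (d, false) F => [node d (forestTrunk F)]
/-- The part `R^c(F)` of a cut forest. -/
def forestTrunk : List (PTree (D × Bool)) → List (PTree D)
  | [] => []
  | t :: F => trunk t ++ forestTrunk F
end

/-- The admissible cuts of a forest, the empty and the total cuts of its trees included: the
markings such that every path meets at most one mark. -/
def cuts (F : PForest D) : List (PForest (D × Bool)) :=
  (forestMarkings F).filter fun c => forestPathMarks c ≤ 1


theorem filter_flatMap_map {α : Type*} (p : α → Bool) (q : List α → Bool) (l : List α)
    (m : List (List α)) (r : List α → Bool) (h : ∀ a b, r (a :: b) = (p a && q b)) :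
    ((l.flatMap fun a => m.map fun b => a :: b).filter r) =
      (l.filter p).flatMap fun a => (m.filter q).map fun b => a :: b := by
  induction l with
  | nil => rfl
  | cons a l ih =>
    rw [List.flatMap_cons, List.filter_append, ih, List.filter_map]
    by_cases ha : p a
    · simp [Function.comp_def, h, ha]
    · simp [Function.comp_def, h, ha]

/-- The admissible cuts of a tree, the empty and the total cut included. -/
def treeCuts (t : PTree D) : List (PTree (D × Bool)) :=
  (markings t).filter fun c => pathMarks c ≤ 1

theorem cuts_nil : cuts ([] : PForest D) = [[]] := by
  simp [cuts, forestMarkings, forestPathMarks]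

theorem cuts_cons (t : PTree D) (F : PForest D) :
    cuts (t :: F) = (treeCuts t).flatMap fun a => (cuts F).map fun b => a :: b := by
  rw [cuts, forestMarkings]
  exact filter_flatMap_map _ _ _ _ _ (fun a b => by simp [forestPathMarks])

mutual
/-- Tree with no mark. -/
def plain : PTree D → PTree (D × Bool)
  | node d F => node (d, false) (forestPlain F)
/-- Forest with no mark. -/
def forestPlain : List (PTree D) → List (PTree (D × Bool))
  | [] => []
  | t :: F => plain t :: forestPlain F
end

mutual
theorem filter_markings_zero : ∀ t : PTree D,
    (markings t).filter (fun c => pathMarks c = 0) = [plain t]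
  | node d F => by
    have := filter_forestMarkings_zero F
    simp [markings, List.filter_map, Function.comp_def, pathMarks, plain, this]
theorem filter_forestMarkings_zero : ∀ F : List (PTree D),
    (forestMarkings F).filter (fun c => forestPathMarks c = 0) = [forestPlain F]
  | [] => by simp [forestMarkings, forestPathMarks, forestPlain]
  | t :: F => by
    rw [forestMarkings, filter_flatMap_map (fun c => pathMarks c = 0)
      (fun c => forestPathMarks c = 0) _ _ _ (fun a b => by simp [forestPathMarks]),
      filter_markings_zero t, filter_forestMarkings_zero F]
    simp [forestPlain]
end

mutual
theorem unmark_plain : ∀ t : PTree D, unmark (plain t) = t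
  | node d F => by simp [plain, unmark, forestUnmark_plain F]
theorem forestUnmark_plain : ∀ F : List (PTree D), forestUnmark (forestPlain F) = F
  | [] => rfl
  | t :: F => by simp [forestPlain, forestUnmark, unmark_plain t, forestUnmark_plain F]
end

theorem treeCuts_node (d : D) (F : PForest D) :
    treeCuts (node d F) = node (d, true) (forestPlain F) :: (cuts F).map (node (d, false)) := by
  have := filter_forestMarkings_zero F
  simp [treeCuts, markings, List.filter_map, Function.comp_def, pathMarks, this, cuts]

mutual
theorem weight_unmark : ∀ c : PTree (D × Bool), weight (unmark c) = weight c
  | node (d, b) F => by simp [unmark, weight, weight_forestUnmark F]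
theorem weight_forestUnmark : ∀ c : List (PTree (D × Bool)),
    forestWeight (forestUnmark c) = forestWeight c
  | [] => rfl
  | t :: F => by simp [forestUnmark, forestWeight, weight_unmark t, weight_forestUnmark F]
end

theorem forestWeight_append {E : Type*} (F G : PForest E) :
    forestWeight (F ++ G) = forestWeight F + forestWeight G := by
  induction F with
  | nil => simp [forestWeight]
  | cons t F ih => simp [forestWeight, ih, add_assoc]

mutual
theorem weight_pruned_trunk : ∀ c : PTree (D × Bool),
    forestWeight (pruned c) + forestWeight (trunk c) = weight c
  | node (d, true) F => by
    rw [pruned, trunk, forestWeight, forestWeight, weight_unmark]; rfl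
  | node (d, false) F => by
    have := weight_forestPruned_trunk F
    simp only [pruned, trunk, forestWeight, weight]; omega
theorem weight_forestPruned_trunk : ∀ c : List (PTree (D × Bool)),
    forestWeight (forestPruned c) + forestWeight (forestTrunk c) = forestWeight c
  | [] => rfl
  | t :: F => by
    have h1 := weight_pruned_trunk t
    have h2 := weight_forestPruned_trunk F
    simp only [forestPruned, forestTrunk, forestWeight_append, forestWeight]; omega
end

mutual
theorem unmark_of_mem : ∀ (t : PTree D), ∀ c ∈ markings t, unmark c = t
  | node d F => by
    have := forestUnmark_of_mem F
    simp only [markings, List.mem_append, List.mem_map]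
    rintro c (⟨a, ha, rfl⟩ | ⟨a, ha, rfl⟩) <;> simp [unmark, this a ha]
theorem forestUnmark_of_mem : ∀ (F : List (PTree D)), ∀ c ∈ forestMarkings F, forestUnmark c = F
  | [] => by simp [forestMarkings, forestUnmark]
  | t :: F => by
    have h1 := unmark_of_mem t
    have h2 := forestUnmark_of_mem F
    simp only [forestMarkings, List.mem_flatMap, List.mem_map]
    rintro c ⟨a, ha, b, hb, rfl⟩
    simp [forestUnmark, h1 a ha, h2 b hb]
end

theorem weight_cut {F : PForest D} {c : PForest (D × Bool)} (hc : c ∈ cuts F) :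
    forestWeight (forestPruned c) + forestWeight (forestTrunk c) = forestWeight F := by
  rw [weight_forestPruned_trunk, ← weight_forestUnmark,
    forestUnmark_of_mem F c (List.mem_of_mem_filter hc)]

theorem eq_nil_of_forestWeight {F : PForest D} (h : forestWeight F = 0) : F = [] := by
  cases F with
  | nil => rfl
  | cons t F => cases t; simp [forestWeight, weight] at h

end PTree

/-- The free associative unital `ℚ`-algebra on the plane rooted trees decorated by `D`. -/
abbrev HPR (D : Type*) : Type _ := FreeAlgebra ℚ (PTree D)

namespace HPR

open PTree

variable {D : Type*}

/-- The monomial `t₁ ⋯ t_n` attached to a forest. -/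
noncomputable def mono (F : PForest D) : HPR D := (F.map (FreeAlgebra.ι ℚ)).prod

theorem mono_nil : mono ([] : PForest D) = 1 := rfl

theorem mono_cons (t : PTree D) (F : PForest D) :
    mono (t :: F) = FreeAlgebra.ι ℚ t * mono F := by simp [mono]

theorem mono_singleton (t : PTree D) : mono [t] = FreeAlgebra.ι ℚ t := by simp [mono]

theorem mono_append (F G : PForest D) : mono (F ++ G) = mono F * mono G := by simp [mono]

variable (D) in
/-- The basis of the free algebra formed by the monomials `mono F`, indexed by the forests. -/
noncomputable def forestBasis : Module.Basis (PForest D) ℚ (HPR D) :=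
  (FreeAlgebra.basisFreeMonoid ℚ (PTree D)).reindex FreeMonoid.toList

@[simp]
theorem forestBasis_apply (F : PForest D) : forestBasis D F = mono F := by
  have : forestBasis D F = FreeAlgebra.equivMonoidAlgebraFreeMonoid.symm
      (MonoidAlgebra.single (FreeMonoid.ofList F) (1 : ℚ)) := by
    simp [forestBasis, FreeAlgebra.basisFreeMonoid]
    try rfl
  rw [this]
  change MonoidAlgebra.lift ℚ (HPR D) (FreeMonoid (PTree D)) (FreeMonoid.lift (FreeAlgebra.ι ℚ))
    (MonoidAlgebra.single (FreeMonoid.ofList F) (1 : ℚ)) = _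
  simp [FreeMonoid.lift_ofList, mono]

/-- The counit: `1` on the empty forest, `0` on all other forests. -/
noncomputable def counitMap : HPR D →ₗ[ℚ] ℚ :=
  (forestBasis D).constr ℚ fun F => if F.isEmpty then 1 else 0

/-- The coproduct: `Δ(F) = ∑ P^c(F) ⊗ R^c(F)` over all admissible cuts `c` of the forest `F`. -/
noncomputable def comulMap : HPR D →ₗ[ℚ] HPR D ⊗[ℚ] HPR D :=
  (forestBasis D).constr ℚ fun F =>
    ((cuts F).map fun c => mono (forestPruned c) ⊗ₜ[ℚ] mono (forestTrunk c)).sum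

/-- The operator `B_d^+`: graft the trees of a forest, in their order, on a common root decorated
by `d`. -/
noncomputable def graft (d : D) : HPR D →ₗ[ℚ] HPR D :=
  (forestBasis D).constr ℚ fun F => mono [node d F]

theorem counitMap_mono (F : PForest D) : counitMap (mono F) = if F.isEmpty then 1 else 0 := by
  rw [← forestBasis_apply, counitMap, Module.Basis.constr_basis]

theorem comulMap_mono (F : PForest D) : comulMap (mono F) =
    ((cuts F).map fun c => mono (forestPruned c) ⊗ₜ[ℚ] mono (forestTrunk c)).sum := by
  rw [← forestBasis_apply, comulMap, Module.Basis.constr_basis]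

theorem graft_mono (d : D) (F : PForest D) : graft d (mono F) = mono [node d F] := by
  rw [← forestBasis_apply, graft, Module.Basis.constr_basis]

theorem comulMap_one : comulMap (1 : HPR D) = 1 := by
  rw [← mono_nil, comulMap_mono, cuts_nil]
  simp [forestPruned, forestTrunk, mono_nil, Algebra.TensorProduct.one_def]

theorem comulMap_mono_singleton (t : PTree D) : comulMap (mono [t]) =
    ((treeCuts t).map fun c => mono (pruned c) ⊗ₜ[ℚ] mono (trunk c)).sum := by
  rw [comulMap_mono, cuts_cons, cuts_nil]
  induction treeCuts t with
  | nil => simp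
  | cons a l ih =>
    rw [List.flatMap_cons, List.map_append, List.sum_append, ih]
    simp [forestPruned, forestTrunk]

theorem comulMap_mono_cons (t : PTree D) (F : PForest D) :
    comulMap (mono (t :: F)) = comulMap (mono [t]) * comulMap (mono F) := by
  rw [comulMap_mono_singleton, comulMap_mono, comulMap_mono, cuts_cons]
  induction treeCuts t with
  | nil => simp
  | cons a l ih =>
    rw [List.flatMap_cons, List.map_append, List.sum_append, ih, List.map_cons, List.sum_cons,
      add_mul]
    simp only [List.map_map, Function.comp_def, forestPruned, forestTrunk, mono_append,
      ← Algebra.TensorProduct.tmul_mul_tmul]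
    rw [List.sum_map_mul_left]

theorem comulMap_mono_append (F G : PForest D) :
    comulMap (mono (F ++ G)) = comulMap (mono F) * comulMap (mono G) := by
  induction F with
  | nil => simp [mono_nil, comulMap_one]
  | cons t F ih =>
    rw [List.cons_append, comulMap_mono_cons, ih, comulMap_mono_cons t F, mul_assoc]

/-- A linear map that is multiplicative on forests is multiplicative. -/
theorem hom_mul {A : Type*} [Ring A] [Algebra ℚ A] (f : HPR D →ₗ[ℚ] A)
    (h : ∀ F G, f (mono (F ++ G)) = f (mono F) * f (mono G)) (x y : HPR D) :
    f (x * y) = f x * f y := by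
  have : (LinearMap.mul ℚ (HPR D)).compr₂ f = (LinearMap.mul ℚ A).compl₁₂ f f := by
    refine (forestBasis D).ext fun F => (forestBasis D).ext fun G => ?_
    simp [← mono_append, h]
  exact LinearMap.congr_fun₂ this x y

theorem comulMap_mul (x y : HPR D) : comulMap (x * y) = comulMap x * comulMap y :=
  hom_mul comulMap comulMap_mono_append x y

theorem counitMap_one : counitMap (1 : HPR D) = 1 := by
  rw [← mono_nil, counitMap_mono]; rfl

theorem counitMap_mul (x y : HPR D) : counitMap (x * y) = counitMap x * counitMap y :=
  hom_mul counitMap (fun F G => by cases F <;> simp [counitMap_mono]) x y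

theorem comulMap_graft (d : D) (x : HPR D) :
    comulMap (graft d x) = graft d x ⊗ₜ 1 + (graft d).lTensor _ (comulMap x) := by
  have : comulMap ∘ₗ graft d = (TensorProduct.mk ℚ _ _).flip 1 ∘ₗ graft d +
      (graft d).lTensor _ ∘ₗ comulMap := by
    refine (forestBasis D).ext fun F => ?_
    simp only [forestBasis_apply, LinearMap.comp_apply, LinearMap.add_apply, graft_mono]
    rw [comulMap_mono_singleton, treeCuts_node, comulMap_mono, map_list_sum, List.map_cons,
      List.map_map, List.map_map, List.sum_cons]
    congr 1
    · simp [pruned, trunk, unmark, forestUnmark_plain, mono_nil]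
    · simp [Function.comp_def, pruned, trunk, graft_mono]
  exact LinearMap.congr_fun this x

variable (D) in
/-- The coproduct as an algebra morphism. -/
noncomputable def comulHom : HPR D →ₐ[ℚ] HPR D ⊗[ℚ] HPR D :=
  AlgHom.ofLinearMap comulMap comulMap_one comulMap_mul

variable (D) in
/-- The counit as an algebra morphism. -/
noncomputable def counitHom : HPR D →ₐ[ℚ] ℚ :=
  AlgHom.ofLinearMap counitMap counitMap_one counitMap_mul

theorem comulHom_graft (d : D) (x : HPR D) :
    comulHom D (graft d x) = graft d x ⊗ₜ 1 + (graft d).lTensor _ (comulHom D x) :=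
  comulMap_graft d x

/-- Two algebra morphisms are equal if their equality is preserved by all the `B_d^+`. -/
theorem algHom_ext {A : Type*} [Ring A] [Algebra ℚ A] (f g : HPR D →ₐ[ℚ] A)
    (h : ∀ d x, f x = g x → f (graft d x) = g (graft d x)) : f = g := by
  ext t
  simp only [Function.comp_apply]
  induction t using PTree.ind with
  | h d F ih =>
    rw [← mono_singleton, ← graft_mono]
    refine h d _ ?_
    rw [mono, map_list_prod, map_list_prod, List.map_map, List.map_map]
    congr 1
    exact List.map_congr_left ih

theorem counitMap_graft (d : D) (x : HPR D) : counitMap (graft d x) = 0 := by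
  have : counitMap ∘ₗ graft d = 0 := (forestBasis D).ext fun F => by
    simp [graft_mono, counitMap_mono]
  exact LinearMap.congr_fun this x

theorem coassoc_aux :
    (Algebra.TensorProduct.assoc ℚ ℚ ℚ (HPR D) (HPR D) (HPR D)).toAlgHom.comp
      ((Algebra.TensorProduct.map (comulHom D) (.id ℚ (HPR D))).comp (comulHom D))
      = (Algebra.TensorProduct.map (.id ℚ (HPR D)) (comulHom D)).comp (comulHom D) := by
  refine algHom_ext _ _ fun d x hx => ?_
  have h1 : ∀ z : HPR D ⊗[ℚ] HPR D,
      Algebra.TensorProduct.assoc ℚ ℚ ℚ (HPR D) (HPR D) (HPR D)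
        (Algebra.TensorProduct.map (comulHom D) (.id ℚ (HPR D)) ((graft d).lTensor _ z)) =
      ((graft d).lTensor _).lTensor _ (Algebra.TensorProduct.assoc ℚ ℚ ℚ (HPR D) (HPR D) (HPR D)
        (Algebra.TensorProduct.map (comulHom D) (.id ℚ (HPR D)) z)) := by
    intro z
    induction z with
    | zero => simp
    | add a b ha hb => simp only [map_add, ha, hb]
    | tmul a b =>
      simp only [LinearMap.lTensor_tmul, Algebra.TensorProduct.map_tmul, AlgHom.coe_id, id]
      induction comulHom D a with
      | zero => simp
      | add a b ha hb => simp only [map_add, TensorProduct.add_tmul, ha, hb]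
      | tmul a b => simp
  have h2 : ∀ z : HPR D ⊗[ℚ] HPR D,
      Algebra.TensorProduct.map (.id ℚ (HPR D)) (comulHom D) ((graft d).lTensor _ z) =
      Algebra.TensorProduct.assoc ℚ ℚ ℚ (HPR D) (HPR D) (HPR D) ((graft d).lTensor _ z ⊗ₜ 1) +
      ((graft d).lTensor _).lTensor _
        (Algebra.TensorProduct.map (.id ℚ (HPR D)) (comulHom D) z) := by
    intro z
    induction z with
    | zero => simp
    | add a b ha hb =>
      simp only [map_add, ha, hb, TensorProduct.add_tmul]
      abel
    | tmul a b => simp [comulHom_graft, TensorProduct.tmul_add]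
  have hx' : Algebra.TensorProduct.assoc ℚ ℚ ℚ (HPR D) (HPR D) (HPR D)
      (Algebra.TensorProduct.map (comulHom D) (.id ℚ (HPR D)) (comulHom D x)) =
      Algebra.TensorProduct.map (.id ℚ (HPR D)) (comulHom D) (comulHom D x) := hx
  change Algebra.TensorProduct.assoc ℚ ℚ ℚ (HPR D) (HPR D) (HPR D)
      (Algebra.TensorProduct.map (comulHom D) (.id ℚ (HPR D)) (comulHom D (graft d x))) =
      Algebra.TensorProduct.map (.id ℚ (HPR D)) (comulHom D) (comulHom D (graft d x))
  rw [comulHom_graft, map_add, map_add, map_add, h1, h2, hx', Algebra.TensorProduct.map_tmul,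
    comulHom_graft, Algebra.TensorProduct.map_tmul, map_one, TensorProduct.add_tmul, map_add]
  simp [Algebra.TensorProduct.one_def, add_assoc]

theorem rTensor_aux :
    (Algebra.TensorProduct.map (counitHom D) (.id ℚ (HPR D))).comp (comulHom D)
      = (Algebra.TensorProduct.lid ℚ (HPR D)).symm := by
  refine algHom_ext _ _ fun d x hx => ?_
  have h1 : ∀ z : HPR D ⊗[ℚ] HPR D,
      Algebra.TensorProduct.map (counitHom D) (.id ℚ (HPR D)) ((graft d).lTensor _ z) =
      (graft d).lTensor _ (Algebra.TensorProduct.map (counitHom D) (.id ℚ (HPR D)) z) := by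
    intro z
    induction z with
    | zero => simp
    | add a b ha hb => simp only [map_add, ha, hb]
    | tmul a b => simp
  have hx' : Algebra.TensorProduct.map (counitHom D) (.id ℚ (HPR D)) (comulHom D x) =
    1 ⊗ₜ x := hx
  change Algebra.TensorProduct.map (counitHom D) (.id ℚ (HPR D)) (comulHom D (graft d x)) =
    1 ⊗ₜ graft d x
  have h0 : counitHom D (graft d x) = 0 := counitMap_graft d x
  rw [comulHom_graft, map_add, h1, hx', Algebra.TensorProduct.map_tmul, h0]
  simp

theorem lTensor_aux :
    (Algebra.TensorProduct.map (.id ℚ (HPR D)) (counitHom D)).comp (comulHom D)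
      = (Algebra.TensorProduct.rid ℚ ℚ (HPR D)).symm := by
  refine algHom_ext _ _ fun d x hx => ?_
  have h0 : ∀ y, counitHom D (graft d y) = 0 := counitMap_graft d
  have h1 : ∀ z : HPR D ⊗[ℚ] HPR D,
      Algebra.TensorProduct.map (.id ℚ (HPR D)) (counitHom D) ((graft d).lTensor _ z) = 0 := by
    intro z
    induction z with
    | zero => simp
    | add a b ha hb => simp only [map_add, ha, hb, add_zero]
    | tmul a b => simp [h0]
  change Algebra.TensorProduct.map (.id ℚ (HPR D)) (counitHom D) (comulHom D (graft d x)) =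
    graft d x ⊗ₜ 1
  rw [comulHom_graft, map_add, h1, Algebra.TensorProduct.map_tmul]
  simp

noncomputable instance : Coalgebra ℚ (HPR D) where
  comul := comulMap
  counit := counitMap
  coassoc := congr(($coassoc_aux).toLinearMap)
  rTensor_counit_comp_comul := congr(($rTensor_aux).toLinearMap)
  lTensor_counit_comp_comul := congr(($lTensor_aux).toLinearMap)

noncomputable instance : Bialgebra ℚ (HPR D) :=
  Bialgebra.mk' ℚ (HPR D) counitMap_one (fun {x y} => counitMap_mul x y) comulMap_one
    (fun {x y} => comulMap_mul x y)

open WithConv in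
/-- The convolution powers of `ηε - id`. -/
noncomputable def convPow (k : ℕ) : WithConv (HPR D →ₗ[ℚ] HPR D) :=
  (1 - toConv LinearMap.id) ^ k

open WithConv in
/-- The antipode: the convolution inverse `∑ k, (ηε - id) ^ k` of the identity, a sum that is
finite on every forest. -/
noncomputable def antipodeMap : HPR D →ₗ[ℚ] HPR D :=
  (forestBasis D).constr ℚ fun F =>
    ∑ k ∈ Finset.range (forestWeight F + 1), (convPow k).ofConv (mono F)

open WithConv in
theorem conv_mono (f g : WithConv (HPR D →ₗ[ℚ] HPR D)) (F : PForest D) :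
    (f * g).ofConv (mono F) =
      ((cuts F).map fun c => f.ofConv (mono (forestPruned c)) *
        g.ofConv (mono (forestTrunk c))).sum := by
  change LinearMap.mul' ℚ (HPR D) (TensorProduct.map f.ofConv g.ofConv (comulMap (mono F))) = _
  rw [comulMap_mono, map_list_sum, map_list_sum, List.map_map, List.map_map]
  simp [Function.comp_def]

open WithConv in
theorem conv_congr {f f' g g' : WithConv (HPR D →ₗ[ℚ] HPR D)} {n : ℕ}
    (hf : ∀ F, forestWeight F ≤ n → f.ofConv (mono F) = f'.ofConv (mono F))
    (hg : ∀ F, forestWeight F ≤ n → g.ofConv (mono F) = g'.ofConv (mono F))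
    {F : PForest D} (hF : forestWeight F ≤ n) :
    (f * g).ofConv (mono F) = (f' * g').ofConv (mono F) := by
  rw [conv_mono, conv_mono]
  congr 1
  refine List.map_congr_left fun c hc => ?_
  have := weight_cut hc
  rw [hf _ (by omega), hg _ (by omega)]

open WithConv in
theorem convPow_mono_eq_zero (k : ℕ) : ∀ F : PForest D, forestWeight F < k →
    (convPow k).ofConv (mono F) = 0 := by
  induction k with
  | zero => intro F h; omega
  | succ k ih =>
    intro F hF
    rw [convPow, pow_succ, conv_mono]
    refine List.sum_eq_zero fun y hy => ?_
    obtain ⟨c, hc, rfl⟩ := List.mem_map.1 hy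
    have hw := weight_cut hc
    by_cases h : forestWeight (forestTrunk c) = 0
    · rw [eq_nil_of_forestWeight h, mono_nil]
      have : (1 - toConv LinearMap.id : WithConv (HPR D →ₗ[ℚ] HPR D)).ofConv 1 = 0 := by
        change algebraMap ℚ (HPR D) (counitMap 1) - 1 = 0
        rw [counitMap_one]; simp
      rw [this, mul_zero]
    · have := ih (forestPruned c) (by omega)
      rw [convPow] at this
      rw [this, zero_mul]

open WithConv in
theorem antipodeMap_mono {n : ℕ} (F : PForest D) (hF : forestWeight F ≤ n) :
    antipodeMap (mono F) =
      (∑ k ∈ Finset.range (n + 1), convPow k : WithConv (HPR D →ₗ[ℚ] HPR D)).ofConv (mono F) := by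
  have h1 : antipodeMap (mono F) =
      ∑ k ∈ Finset.range (forestWeight F + 1), (convPow k).ofConv (mono F) := by
    rw [← forestBasis_apply, antipodeMap, Module.Basis.constr_basis, forestBasis_apply]
  have h2 : (∑ k ∈ Finset.range (n + 1), convPow k :
      WithConv (HPR D →ₗ[ℚ] HPR D)).ofConv (mono F) =
      ∑ k ∈ Finset.range (n + 1), (convPow k).ofConv (mono F) := by
    simp
  rw [h1, h2]
  refine Finset.sum_subset (fun i hi => ?_) fun i _ hi => ?_
  · simp only [Finset.mem_range] at *; omega
  · exact convPow_mono_eq_zero i F (by simp only [Finset.mem_range] at hi; omega)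

open WithConv in
theorem antipode_convMul_id :
    (toConv antipodeMap * toConv LinearMap.id : WithConv (HPR D →ₗ[ℚ] HPR D)) = 1 := by
  refine WithConv.ext ((forestBasis D).ext fun F => ?_)
  rw [forestBasis_apply, conv_congr (f := toConv antipodeMap) (f' := ∑ k ∈ Finset.range (forestWeight F + 1), convPow k)
    (fun G hG => antipodeMap_mono G hG) (fun _ _ => rfl) le_rfl]
  have h' := geom_sum_mul_neg (1 - toConv LinearMap.id : WithConv (HPR D →ₗ[ℚ] HPR D))
    (forestWeight F + 1)
  rw [sub_sub_cancel] at h'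
  have e : (∑ k ∈ Finset.range (forestWeight F + 1), convPow k) * toConv LinearMap.id =
    (1 : WithConv (HPR D →ₗ[ℚ] HPR D)) - convPow (forestWeight F + 1) := h'
  rw [e, ofConv_sub, LinearMap.sub_apply, convPow_mono_eq_zero _ F (by omega), sub_zero]

open WithConv in
theorem id_convMul_antipode :
    (toConv LinearMap.id * toConv antipodeMap : WithConv (HPR D →ₗ[ℚ] HPR D)) = 1 := by
  refine WithConv.ext ((forestBasis D).ext fun F => ?_)
  rw [forestBasis_apply, conv_congr (g := toConv antipodeMap) (g' := ∑ k ∈ Finset.range (forestWeight F + 1), convPow k)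
    (fun _ _ => rfl) (fun G hG => antipodeMap_mono G hG) le_rfl]
  have h := mul_neg_geom_sum (1 - toConv LinearMap.id : WithConv (HPR D →ₗ[ℚ] HPR D))
    (forestWeight F + 1)
  rw [sub_sub_cancel] at h
  have e : toConv LinearMap.id * (∑ k ∈ Finset.range (forestWeight F + 1), convPow k) =
    (1 : WithConv (HPR D →ₗ[ℚ] HPR D)) - convPow (forestWeight F + 1) := h
  rw [e, ofConv_sub, LinearMap.sub_apply, convPow_mono_eq_zero _ F (by omega), sub_zero]

noncomputable instance : HopfAlgebra ℚ (HPR D) :=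
  HopfAlgebra.ofConvInverse antipodeMap antipode_convMul_id id_convMul_antipode

open Classical in
/-- The operator `γ_d`: it sends `t₁ ⋯ t_n` to `t₁ ⋯ t_{n-1}` if `t_n` is the one-vertex tree
decorated by `d`, and every other forest (the empty one included) to `0`. -/
noncomputable def cutLast (d : D) : HPR D →ₗ[ℚ] HPR D :=
  (forestBasis D).constr ℚ fun F =>
    if F.getLast? = some (node d []) then mono F.dropLast else 0

variable (D) in
/-- The homogeneous elements of weight `n`. -/
def homogeneous (n : ℕ) : Submodule ℚ (HPR D) :=
  Submodule.span ℚ {x | ∃ F : PForest D, forestWeight F = n ∧ x = mono F}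

variable (D) in
/-- The primitive elements. -/
def primitives : Submodule ℚ (HPR D) where
  carrier := {x | Coalgebra.comul (R := ℚ) x = x ⊗ₜ[ℚ] 1 + 1 ⊗ₜ[ℚ] x}
  zero_mem' := by simp
  add_mem' {x y} hx hy := by
    simp only [Set.mem_ofPred_eq] at hx hy ⊢
    rw [map_add, hx, hy, TensorProduct.add_tmul, TensorProduct.tmul_add]
    abel
  smul_mem' r x hx := by
    simp only [Set.mem_ofPred_eq] at hx ⊢
    rw [map_smul, hx, smul_add, TensorProduct.smul_tmul', TensorProduct.tmul_smul]

/-- The three conditions that characterize the bilinear form. In the second one `B.tmul B` is the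
form on the tensor square with `(x₁ ⊗ x₂, y₁ ⊗ y₂) = (x₁, y₁) (x₂, y₂)`. -/
structure IsPairing (B : LinearMap.BilinForm ℚ (HPR D)) : Prop where
  one_left : ∀ x, B 1 x = Coalgebra.counit (R := ℚ) x
  mul_left : ∀ x₁ x₂ y, B (x₁ * x₂) y = B.tmul B (x₁ ⊗ₜ[ℚ] x₂) (Coalgebra.comul (R := ℚ) y)
  graft_left : ∀ x y d, B (graft d x) y = B x (cutLast d y)

open Classical in
/-- The family `e` satisfies `(e_F, G) = δ_{F,G}` for all forests `F`, `G`. -/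
def IsDualFamily (B : LinearMap.BilinForm ℚ (HPR D)) (e : PForest D → HPR D) : Prop :=
  ∀ F G, B (e F) (mono G) = if F = G then 1 else 0

end HPR

/-!
A form with the three properties is the same thing as an algebra morphism `x ↦ (x, ·)` from `H` to
the convolution algebra of its dual, and the third property prescribes this morphism on trees, by
recursion on the weight: this gives existence and uniqueness. Since `γ_d` satisfies
`γ_d(x y) = x γ_d(y) + ε(y) γ_d(x)`, dual to `Δ(B_d^+(x)) = B_d^+(x) ⊗ 1 + (id ⊗ B_d^+)(Δ(x))`, the
form with exchanged arguments has the same three properties, hence the form is symmetric. It is then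
a Hopf pairing, and the antipode is self-adjoint.

Let `F = T t`, where the last tree `t` has root `d` and `G` is the forest of the subtrees attached
to this root. If `e_G` and `e_T` are known, then `e_G B_d^+(e_T)` pairs as `e_F` should with the
forests `H t'` such that the forest attached to the root of `t'` has weight at least that of `G`.
The other forests of the same weight come earlier in an induction on the weight of `G`, so `e_F` is
obtained by subtracting multiples of their dual elements. Their number is finite even if the set of
decorations is infinite, because the form is graded by the multiset of decorations.
-/

open Coalgebra WithConv

theorem sum_range_take_drop {α R : Type*} [DecidableEq α] [AddCommMonoidWithOne R]
    (F G K : List α) :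
    ∑ i ∈ Finset.range (F.length + 1), (if F.take i = G ∧ F.drop i = K then (1 : R) else 0) =
      if F = G ++ K then 1 else 0 := by
  have iff_of_mem (i : ℕ) (hi : i ∈ Finset.range (F.length + 1)) :
      F.take i = G ∧ F.drop i = K ↔ i = G.length ∧ F = G ++ K := by
    rw [Finset.mem_range] at hi
    constructor
    · rintro ⟨rfl, rfl⟩
      exact ⟨by rw [List.length_take]; omega, (List.take_append_drop i F).symm⟩
    · rintro ⟨rfl, rfl⟩
      simp
  rw [Finset.sum_congr rfl fun i hi => if_congr (iff_of_mem i hi) rfl rfl]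
  by_cases hF : F = G ++ K
  · have : G.length < F.length + 1 := by rw [hF, List.length_append]; omega
    simp_all
  · simp [hF]

section BasisCoord

variable {ι R M : Type*} [CommSemiring R] [AddCommMonoid M] [Module R M]

theorem coord_apply_basis [DecidableEq ι] (b : Module.Basis ι R M) (i j : ι) :
    b.coord i (b j) = if i = j then 1 else 0 := by
  rw [b.coord_apply, b.repr_self, Finsupp.single_apply]
  exact if_congr eq_comm rfl rfl

theorem functional_mem_of_coord_mem (b : Module.Basis ι R M) {N : Submodule R (M →ₗ[R] R)}
    {f : M →ₗ[R] R} (hfin : {i | f (b i) ≠ 0}.Finite) (hN : ∀ i, f (b i) ≠ 0 → b.coord i ∈ N) :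
    f ∈ N := by
  classical
  have hf : f = ∑ i ∈ hfin.toFinset, f (b i) • b.coord i := b.ext fun j => by
    simp only [LinearMap.sum_apply, LinearMap.smul_apply, coord_apply_basis, smul_eq_mul, mul_ite,
      mul_one, mul_zero, Finset.sum_ite_eq', Set.Finite.mem_toFinset, Set.mem_ofPred_eq]
    by_cases hj : f (b j) = 0 <;> simp [hj]
  rw [hf]
  exact sum_mem fun i hi => N.smul_mem _ (hN i ((Set.Finite.mem_toFinset hfin).1 hi))

end BasisCoord

theorem sum_counit_right_smul_left {R C : Type*} [CommSemiring R] [AddCommMonoid C] [Module R C]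
    [Coalgebra R C] (y : C) :
    ∑ i ∈ (ℛ R y).index, counit (R := R) ((ℛ R y).right i) • (ℛ R y).left i = y := by
  simpa only [map_sum, TensorProduct.rid_tmul, one_smul] using
    congr(TensorProduct.rid R C $(sum_tmul_counit_eq (ℛ R y)))

theorem bilinForm_tmul_flip {R M : Type*} [CommSemiring R] [AddCommMonoid M] [Module R M]
    (B : LinearMap.BilinForm R M) (z w : M ⊗[R] M) :
    LinearMap.BilinForm.tmul (LinearMap.flip B) (LinearMap.flip B) z w = B.tmul B w z := by
  have : LinearMap.BilinForm.tmul (LinearMap.flip B) (LinearMap.flip B) =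
      LinearMap.flip (B.tmul B) := by
    ext; rfl
  rw [this, LinearMap.flip_apply]

section Convolution

variable {R C : Type*} [CommSemiring R] [AddCommMonoid C] [Module R C] [Coalgebra R C]
  (B : LinearMap.BilinForm R C)

theorem toConv_mul_toConv_apply (x₁ x₂ y : C) :
    (toConv (B x₁) * toConv (B x₂)) y = B.tmul B (x₁ ⊗ₜ[R] x₂) (comul (R := R) y) := by
  have : LinearMap.mul' R R ∘ₗ TensorProduct.map (B x₁) (B x₂) = B.tmul B (x₁ ⊗ₜ[R] x₂) :=
    TensorProduct.ext' fun a b => by simp [mul_comm]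
  exact LinearMap.congr_fun this _

theorem tmul_comul_eq_sum (x₁ x₂ y : C) : B.tmul B (x₁ ⊗ₜ[R] x₂) (comul (R := R) y) =
    ∑ i ∈ (ℛ R y).index, B x₁ ((ℛ R y).left i) * B x₂ ((ℛ R y).right i) := by
  rw [← toConv_mul_toConv_apply, (ℛ R y).convMul_apply]

theorem tmul_comul_eq_sum' (x y₁ y₂ : C) : B.tmul B (comul (R := R) x) (y₁ ⊗ₜ[R] y₂) =
    ∑ i ∈ (ℛ R x).index, B ((ℛ R x).left i) y₁ * B ((ℛ R x).right i) y₂ := by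
  rw [← bilinForm_tmul_flip, tmul_comul_eq_sum]
  rfl

end Convolution

theorem tmul_mul_tmul_one_of_apply_mul {R H : Type*} [CommSemiring R] [Semiring H] [Bialgebra R H]
    (B : LinearMap.BilinForm R H) {u y : H} {r : R}
    (hu : ∀ x, B u (x * y) = r * counit (R := R) x) (v x : H) :
    B.tmul B (u ⊗ₜ[R] v) (comul (R := R) x * (y ⊗ₜ[R] 1)) = r * B v x := by
  calc B.tmul B (u ⊗ₜ[R] v) (comul (R := R) x * (y ⊗ₜ[R] 1))
      = r * B v (∑ i ∈ (ℛ R x).index, counit (R := R) ((ℛ R x).left i) • (ℛ R x).right i) := by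
        rw [← (ℛ R x).eq]
        simp [Finset.sum_mul, Finset.mul_sum, hu, mul_assoc, mul_comm]
    _ = r * B v x := by rw [sum_counit_smul]

/-- A bilinear form on a bialgebra for which the product is adjoint to the coproduct and the unit to
the counit, on both sides. On the tensor square, `B.tmul B` is the form with
`(x₁ ⊗ x₂, y₁ ⊗ y₂) = (x₁, y₁) (x₂, y₂)`. -/
structure IsHopfPairing {R H : Type*} [CommSemiring R] [Semiring H] [Bialgebra R H]
    (B : LinearMap.BilinForm R H) : Prop where
  one_left : ∀ x, B 1 x = counit (R := R) x
  one_right : ∀ x, B x 1 = counit (R := R) x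
  mul_left : ∀ x₁ x₂ y, B (x₁ * x₂) y = B.tmul B (x₁ ⊗ₜ[R] x₂) (comul (R := R) y)
  mul_right : ∀ x y₁ y₂, B x (y₁ * y₂) = B.tmul B (comul (R := R) x) (y₁ ⊗ₜ[R] y₂)

namespace IsHopfPairing

section Bialgebra

variable {R H : Type*} [CommSemiring R] [Semiring H] [Bialgebra R H] {B : LinearMap.BilinForm R H}

theorem apply_mul_of_comul_eq (h : IsHopfPairing B) {x : H}
    (hx : comul (R := R) x = x ⊗ₜ[R] 1 + 1 ⊗ₜ[R] x) (y₁ y₂ : H) :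
    B x (y₁ * y₂) = B x y₁ * counit (R := R) y₂ + counit (R := R) y₁ * B x y₂ := by
  rw [h.mul_right, hx]
  simp [h.one_left, mul_comm]

end Bialgebra

variable {R H : Type*} [CommSemiring R] [Semiring H] [HopfAlgebra R H] {B : LinearMap.BilinForm R H}

theorem antipode_left (h : IsHopfPairing B) (x y : H) :
    B (HopfAlgebra.antipode R x) y = B x (HopfAlgebra.antipode R y) := by
  let S : H →ₗ[R] H := HopfAlgebra.antipode R
  let b : WithConv (H ⊗[R] H →ₗ[R] R) := toConv (TensorProduct.lift B)
  let b₁ : WithConv (H ⊗[R] H →ₗ[R] R) := toConv (TensorProduct.lift (B ∘ₗ S))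
  let b₂ : WithConv (H ⊗[R] H →ₗ[R] R) := toConv (TensorProduct.lift (B.compl₂ S))
  have one_apply (x y : H) : (1 : WithConv (H ⊗[R] H →ₗ[R] R)) (x ⊗ₜ[R] y) =
      counit (R := R) x * counit (R := R) y := by
    simp [LinearMap.convOne_apply, mul_comm]
  have left_inv : b₁ * b = 1 := by
    refine WithConv.ext (TensorProduct.ext' fun x y => ?_)
    calc (b₁ * b) (x ⊗ₜ[R] y)
        = B (∑ i ∈ (ℛ R x).index, S ((ℛ R x).left i) * (ℛ R x).right i) y := by
          rw [((ℛ R x).tmul (ℛ R y)).convMul_apply]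
          simp [b, b₁, S, h.mul_left, tmul_comul_eq_sum, Finset.sum_product, LinearMap.sum_apply]
      _ = (1 : WithConv (H ⊗[R] H →ₗ[R] R)) (x ⊗ₜ[R] y) := by
          rw [HopfAlgebra.sum_antipode_mul_eq_algebraMap_counit, one_apply,
            Algebra.algebraMap_eq_smul_one, map_smul, LinearMap.smul_apply, h.one_left, smul_eq_mul]
  have right_inv : b * b₂ = 1 := by
    refine WithConv.ext (TensorProduct.ext' fun x y => ?_)
    calc (b * b₂) (x ⊗ₜ[R] y)
        = B x (∑ i ∈ (ℛ R y).index, (ℛ R y).left i * S ((ℛ R y).right i)) := by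
          rw [((ℛ R x).tmul (ℛ R y)).convMul_apply]
          simp [b, b₂, S, h.mul_right, tmul_comul_eq_sum', Finset.sum_product_right]
      _ = (1 : WithConv (H ⊗[R] H →ₗ[R] R)) (x ⊗ₜ[R] y) := by
          rw [HopfAlgebra.sum_mul_antipode_eq_algebraMap_counit, one_apply,
            Algebra.algebraMap_eq_smul_one, map_smul, h.one_right, smul_eq_mul, mul_comm]
  exact congr(($(left_inv_eq_right_inv left_inv right_inv)).ofConv (x ⊗ₜ[R] y))

end IsHopfPairing

section RightMultiplicativity

variable {R H : Type*} [CommSemiring R] [Semiring H] [Bialgebra R H] {B : LinearMap.BilinForm R H}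

theorem toConv_apply_mul
    (hB : ∀ x₁ x₂ y, B (x₁ * x₂) y = B.tmul B (x₁ ⊗ₜ[R] x₂) (comul (R := R) y)) (x₁ x₂ : H) :
    toConv (B (x₁ * x₂)) = toConv (B x₁) * toConv (B x₂) :=
  WithConv.ext (LinearMap.ext fun y => (hB x₁ x₂ y).trans (toConv_mul_toConv_apply B x₁ x₂ y).symm)

theorem toConv_tmul_apply_mul
    (hB : ∀ x₁ x₂ y, B (x₁ * x₂) y = B.tmul B (x₁ ⊗ₜ[R] x₂) (comul (R := R) y))
    (z w : H ⊗[R] H) :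
    toConv (B.tmul B (z * w)) = toConv (B.tmul B z) * toConv (B.tmul B w) := by
  induction z with
  | zero => simp
  | add z₁ z₂ h₁ h₂ => simp only [add_mul, map_add, toConv_add, h₁, h₂]
  | tmul x₁ x₂ =>
    induction w with
    | zero => simp
    | add w₁ w₂ h₁ h₂ => simp only [mul_add, map_add, toConv_add, h₁, h₂]
    | tmul x₁' x₂' =>
      refine WithConv.ext (TensorProduct.ext' fun y₁ y₂ => ?_)
      refine .trans ?_ (((ℛ R y₁).tmul (ℛ R y₂)).convMul_apply _ _).symm
      simp only [Algebra.TensorProduct.tmul_mul_tmul, LinearMap.BilinForm.tensorDistrib_tmul, hB,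
        tmul_comul_eq_sum, smul_eq_mul, Coalgebra.Repr.tmul, Finset.sum_product_right,
        Finset.sum_mul_sum]
      exact Finset.sum_congr rfl fun i _ => Finset.sum_congr rfl fun j _ => mul_mul_mul_comm ..

theorem mul_right_of_mul
    (hB : ∀ x₁ x₂ y, B (x₁ * x₂) y = B.tmul B (x₁ ⊗ₜ[R] x₂) (comul (R := R) y)) {x x' : H}
    (hx : ∀ y₁ y₂, B x (y₁ * y₂) = B.tmul B (comul (R := R) x) (y₁ ⊗ₜ[R] y₂))
    (hx' : ∀ y₁ y₂, B x' (y₁ * y₂) = B.tmul B (comul (R := R) x') (y₁ ⊗ₜ[R] y₂)) (y₁ y₂ : H) :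
    B (x * x') (y₁ * y₂) = B.tmul B (comul (R := R) (x * x')) (y₁ ⊗ₜ[R] y₂) := by
  have comp_mul {x : H} (hx : ∀ y₁ y₂, B x (y₁ * y₂) = B.tmul B (comul (R := R) x) (y₁ ⊗ₜ[R] y₂)) :
      B x ∘ₗ LinearMap.mul' R H = B.tmul B (comul (R := R) x) := TensorProduct.ext' hx
  have key : toConv (B (x * x') ∘ₗ LinearMap.mul' R H) =
      toConv (B.tmul B (comul (R := R) (x * x'))) :=
    calc toConv (B (x * x') ∘ₗ LinearMap.mul' R H)
        = toConv ((toConv (B x) * toConv (B x')).ofConv ∘ₗ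
            (Bialgebra.mulCoalgHom R H).toLinearMap) := by
          rw [← toConv_apply_mul hB]; rfl
      _ = toConv (B x ∘ₗ LinearMap.mul' R H) * toConv (B x' ∘ₗ LinearMap.mul' R H) :=
          congrArg toConv (LinearMap.convMul_comp_coalgHom_distrib (toConv (B x)) (toConv (B x'))
            (Bialgebra.mulCoalgHom R H))
      _ = toConv (B.tmul B (comul (R := R) x)) * toConv (B.tmul B (comul (R := R) x')) := by
          rw [comp_mul hx, comp_mul hx']
      _ = toConv (B.tmul B (comul (R := R) (x * x'))) := by
          rw [Bialgebra.comul_mul, toConv_tmul_apply_mul hB]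
  exact congr(($key).ofConv (y₁ ⊗ₜ[R] y₂))

end RightMultiplicativity

namespace PTree

variable {D : Type*}

theorem forest_induction {p : PForest D → Prop} (nil : p [])
    (cons : ∀ d F G, p F → p G → p (node d F :: G)) : ∀ F, p F
  | [] => nil
  | node d F :: G => cons d F G (forest_induction nil cons F) (forest_induction nil cons G)

/-- The multiset of the decorations of the vertices of a forest, a degree that refines the weight
and, unlike it, has finite fibres even if `D` is infinite. -/
def decorations : PForest D → Multiset D
  | [] => 0
  | node d F :: G => d ::ₘ (decorations F + decorations G)

theorem decorations_append (F G : PForest D) :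
    decorations (F ++ G) = decorations F + decorations G := by
  induction F with
  | nil => simp [decorations]
  | cons t F ih => obtain ⟨d, F'⟩ := t; simp [decorations, ih, add_assoc]

theorem card_decorations (F : PForest D) : (decorations F).card = forestWeight F := by
  induction F using forest_induction with
  | nil => simp [decorations, forestWeight]
  | cons d F G hF hG =>
    simp only [decorations, forestWeight, weight, Multiset.card_cons, Multiset.card_add, hF, hG]
    omega

theorem decorations_pruned_add_trunk (c : PForest (D × Bool)) :
    decorations (forestPruned c) + decorations (forestTrunk c) = decorations (forestUnmark c) := by
  induction c using forest_induction with
  | nil => simp [forestPruned, forestTrunk, forestUnmark, decorations]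
  | cons a c c' hc hc' =>
    obtain ⟨d, _ | _⟩ := a <;>
      simp only [forestPruned, pruned, forestTrunk, trunk, forestUnmark, unmark, decorations,
        decorations_append, ← hc, ← hc', Multiset.cons_add, Multiset.add_cons, add_zero,
        zero_add] <;>
      ac_rfl

theorem decorations_cut {F : PForest D} {c : PForest (D × Bool)} (hc : c ∈ cuts F) :
    decorations (forestPruned c) + decorations (forestTrunk c) = decorations F := by
  rw [decorations_pruned_add_trunk, forestUnmark_of_mem F c (List.mem_of_mem_filter hc)]

theorem finite_decorations_eq (m : Multiset D) : {F : PForest D | decorations F = m}.Finite := by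
  classical
  induction m using Multiset.strongInductionOn with
  | ih m ih =>
    have hlt {d : D} (hd : d ∈ m) {a b : Multiset D} (hab : (a, b) ∈ (m.erase d).antidiagonal) :
        a < m ∧ b < m := by
      rw [Multiset.mem_antidiagonal] at hab
      exact ⟨(Multiset.le_add_right a b).trans_lt (hab ▸ Multiset.erase_lt.2 hd),
        (Multiset.le_add_left b a).trans_lt (hab ▸ Multiset.erase_lt.2 hd)⟩
    have hfin : (⋃ d ∈ m.toFinset, ⋃ p ∈ (m.erase d).antidiagonal.toFinset,
        Set.image2 (fun F G => node d F :: G) {F | decorations F = p.1}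
          {G | decorations G = p.2}).Finite :=
      m.toFinset.finite_toSet.biUnion fun d hd =>
        (m.erase d).antidiagonal.toFinset.finite_toSet.biUnion fun p hp =>
          have h := hlt (Multiset.mem_toFinset.1 hd) (Multiset.mem_toFinset.1 hp)
          (ih p.1 h.1).image2 _ (ih p.2 h.2)
    refine (hfin.insert []).subset ?_
    rintro (_ | ⟨⟨d, F⟩, G⟩) (rfl : decorations _ = m)
    · exact Set.mem_insert _ _
    · refine Set.mem_insert_of_mem _ ?_
      simp only [Set.mem_iUnion, Multiset.mem_toFinset, Multiset.mem_antidiagonal]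
      exact ⟨d, by simp [decorations], (decorations F, decorations G), by simp [decorations],
        F, rfl, G, rfl, rfl⟩

end PTree

namespace HPR

open PTree

variable {D : Type*}

theorem graft_induction {p : HPR D → Prop} (one : p 1) (add : ∀ x y, p x → p y → p (x + y))
    (smul : ∀ (r : ℚ) x, p x → p (r • x)) (mul : ∀ x y, p x → p y → p (x * y))
    (graft : ∀ d x, p x → p (graft d x)) (x : HPR D) : p x := by
  induction (forestBasis D).mem_span x using Submodule.span_induction with
  | zero => simpa using smul 0 1 one
  | add x y _ _ hx hy => exact add x y hx hy
  | smul r x _ hx => exact smul r x hx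
  | mem x hx =>
    obtain ⟨F, rfl⟩ := hx
    rw [forestBasis_apply]
    induction F using forest_induction with
    | nil => exact one
    | cons d F G hF hG =>
      rw [mono_cons, ← mono_singleton, ← graft_mono]
      exact mul _ _ (graft d _ hF) hG

theorem comul_mono (F : PForest D) : comul (R := ℚ) (mono F) =
    ((cuts F).map fun c => mono (forestPruned c) ⊗ₜ[ℚ] mono (forestTrunk c)).sum :=
  comulMap_mono F

theorem comul_graft (d : D) (x : HPR D) :
    comul (R := ℚ) (graft d x) = graft d x ⊗ₜ 1 + (graft d).lTensor _ (comul (R := ℚ) x) :=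
  comulMap_graft d x

theorem counit_mono (F : PForest D) : counit (R := ℚ) (mono F) = if F.isEmpty then 1 else 0 :=
  counitMap_mono F

theorem counit_graft (d : D) (x : HPR D) : counit (R := ℚ) (graft d x) = 0 :=
  counitMap_graft d x

open Classical in
theorem cutLast_mono (d : D) (F : PForest D) : cutLast d (mono F) =
    if F.getLast? = some (node d []) then mono F.dropLast else 0 := by
  rw [← forestBasis_apply, cutLast, Module.Basis.constr_basis]

theorem cutLast_one (d : D) : cutLast d (1 : HPR D) = 0 := by
  simp [← mono_nil, cutLast_mono]

open Classical in
theorem cutLast_mono_concat (d : D) (F : PForest D) (t : PTree D) :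
    cutLast d (mono (F ++ [t])) = if t = node d [] then mono F else 0 := by
  simp [cutLast_mono]

theorem exists_eq_concat_of_cutLast_mono_ne_zero {d : D} {F : PForest D}
    (hF : cutLast d (mono F) ≠ 0) :
    ∃ G, F = G ++ [node d []] ∧ cutLast d (mono F) = mono G := by
  classical
  rcases List.eq_nil_or_concat F with rfl | ⟨G, t, rfl⟩
  · exact absurd (cutLast_one d) hF
  · rw [List.concat_eq_append, cutLast_mono_concat] at hF ⊢
    obtain rfl : t = node d [] := by_contra fun ht => hF (if_neg ht)
    exact ⟨G, rfl, if_pos rfl⟩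

theorem cutLast_mul (d : D) (x y : HPR D) :
    cutLast d (x * y) = x * cutLast d y + counit (R := ℚ) y • cutLast d x := by
  have bilinear_eq : (LinearMap.mul ℚ (HPR D)).compr₂ (cutLast d) =
      (LinearMap.mul ℚ (HPR D)).compl₂ (cutLast d) +
        (LinearMap.lsmul ℚ (HPR D)).flip.compl₁₂ (cutLast d) (counit (R := ℚ)) := by
    refine (forestBasis D).ext fun F => (forestBasis D).ext fun G => ?_
    simp only [LinearMap.compr₂_apply, LinearMap.mul_apply_apply, LinearMap.add_apply,
      LinearMap.compl₂_apply, LinearMap.compl₁₂_apply, LinearMap.flip_apply,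
      LinearMap.lsmul_apply, forestBasis_apply, ← mono_append, counit_mono]
    rcases List.eq_nil_or_concat G with rfl | ⟨G, t, rfl⟩
    · simp [mono_nil, cutLast_one]
    · rw [List.concat_eq_append, ← List.append_assoc, cutLast_mono_concat, cutLast_mono_concat]
      split_ifs <;> simp_all [mono_append]
  exact LinearMap.congr_fun₂ bilinear_eq x y

theorem cutLast_graft_of_ne {d d' : D} (hd : d' ≠ d) (x : HPR D) : cutLast d (graft d' x) = 0 := by
  have : cutLast d ∘ₗ graft d' = 0 := (forestBasis D).ext fun F => by
    simp [graft_mono, cutLast_mono, hd]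
  exact LinearMap.congr_fun this x

theorem cutLast_graft_self (d : D) (x : HPR D) :
    cutLast d (graft d x) = algebraMap ℚ (HPR D) (counit (R := ℚ) x) := by
  have : cutLast d ∘ₗ graft d = Algebra.linearMap ℚ (HPR D) ∘ₗ counit (R := ℚ) :=
    (forestBasis D).ext fun F => by
      cases F with
      | nil => simpa [graft_mono, cutLast_mono, counit_mono] using mono_nil
      | cons t F => simp [graft_mono, cutLast_mono, counit_mono]
  exact LinearMap.congr_fun this x

theorem mono_mem_homogeneous (F : PForest D) : mono F ∈ homogeneous D (forestWeight F) :=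
  Submodule.subset_span ⟨F, rfl, rfl⟩

theorem mul_mem_homogeneous {m n : ℕ} {x y : HPR D} (hx : x ∈ homogeneous D m)
    (hy : y ∈ homogeneous D n) : x * y ∈ homogeneous D (m + n) := by
  have hxy := Submodule.mul_mem_mul hx hy
  rw [homogeneous, homogeneous, Submodule.span_mul_span] at hxy
  refine Submodule.span_mono ?_ hxy
  rintro _ ⟨_, ⟨F, rfl, rfl⟩, _, ⟨G, rfl, rfl⟩, rfl⟩
  exact ⟨F ++ G, forestWeight_append F G, (mono_append F G).symm⟩

theorem graft_mem_homogeneous {n : ℕ} {x : HPR D} (hx : x ∈ homogeneous D n) (d : D) :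
    graft d x ∈ homogeneous D (n + 1) := by
  have hdx := Submodule.mem_map_of_mem (f := graft d) hx
  rw [homogeneous, Submodule.map_span] at hdx
  refine Submodule.span_mono ?_ hdx
  rintro _ ⟨_, ⟨F, rfl, rfl⟩, rfl⟩
  exact ⟨[node d F], by simp [forestWeight, weight], graft_mono d F⟩

open Classical in
theorem coord_mono (F G : PForest D) :
    (forestBasis D).coord F (mono G) = if F = G then 1 else 0 := by
  rw [← forestBasis_apply, coord_apply_basis]

open Classical in
theorem coord_mul_mono {G K : PForest D} (hK : forestWeight G ≤ forestWeight K) (x : HPR D) :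
    (forestBasis D).coord G (x * mono K) = (if K = G then 1 else 0) * counit (R := ℚ) x := by
  have comp_eq : (forestBasis D).coord G ∘ₗ LinearMap.mulRight ℚ (mono K) =
      (if K = G then (1 : ℚ) else 0) • counit (R := ℚ) := by
    refine (forestBasis D).ext fun A => ?_
    have eq_append_iff : G = A ++ K ↔ K = G ∧ A.isEmpty := by
      refine ⟨?_, by simp +contextual⟩
      rintro rfl
      rw [forestWeight_append] at hK
      simp [eq_nil_of_forestWeight (F := A) (by omega)]
    simp only [forestBasis_apply, LinearMap.comp_apply, LinearMap.mulRight_apply, ← mono_append,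
      coord_mono, LinearMap.smul_apply, counit_mono, smul_eq_mul, ite_mul, one_mul, zero_mul,
      eq_append_iff, ite_and]
  exact LinearMap.congr_fun comp_eq x

theorem coord_nil : (forestBasis D).coord [] = counit (R := ℚ) := by
  classical
  refine (forestBasis D).ext fun G => ?_
  rw [forestBasis_apply, coord_mono, counit_mono]
  cases G <;> rfl

section Existence

mutual
/-- The linear form `(t, ·)` attached to a tree. -/
noncomputable def treeForm : PTree D → WithConv (HPR D →ₗ[ℚ] ℚ)
  | node d F => toConv ((forestForm F).ofConv ∘ₗ cutLast d)
/-- The linear form `(F, ·)` attached to a forest: the convolution product of the forms attached to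
its trees. -/
noncomputable def forestForm : PForest D → WithConv (HPR D →ₗ[ℚ] ℚ)
  | [] => 1
  | t :: F => treeForm t * forestForm F
end

variable (D) in
/-- The algebra morphism `x ↦ (x, ·)` from `H` to the convolution algebra of its dual. -/
noncomputable def pairingHom : HPR D →ₐ[ℚ] WithConv (HPR D →ₗ[ℚ] ℚ) :=
  FreeAlgebra.lift ℚ treeForm

theorem pairingHom_mono (F : PForest D) : pairingHom D (mono F) = forestForm F := by
  induction F with
  | nil => rw [mono_nil, map_one, forestForm]
  | cons t F ih => rw [mono_cons, map_mul, ih, pairingHom, FreeAlgebra.lift_ι_apply, forestForm]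

theorem pairingHom_graft (d : D) (x : HPR D) :
    pairingHom D (graft d x) = toConv ((pairingHom D x).ofConv ∘ₗ cutLast d) := by
  induction (forestBasis D).mem_span x using Submodule.span_induction with
  | zero => simp
  | add x y _ _ hx hy => simp [hx, hy, LinearMap.add_comp]
  | smul r x _ hx => simp [hx, LinearMap.smul_comp]
  | mem x hx =>
    obtain ⟨F, rfl⟩ := hx
    rw [forestBasis_apply, graft_mono, pairingHom_mono, pairingHom_mono, forestForm, forestForm,
      mul_one, treeForm]

variable (D) in
/-- The bilinear form with `(t₁ ⋯ t_n, ·) = (t₁, ·) * ⋯ * (t_n, ·)` and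
`(B_d^+(x), ·) = (x, γ_d(·))`. -/
noncomputable def pairing : LinearMap.BilinForm ℚ (HPR D) :=
  (WithConv.linearEquiv ℚ (HPR D →ₗ[ℚ] ℚ)).toLinearMap ∘ₗ (pairingHom D).toLinearMap

theorem isPairing_pairing : IsPairing (pairing D) where
  one_left x := congr(($(map_one (pairingHom D))).ofConv x)
  mul_left x₁ x₂ y := by
    rw [← toConv_mul_toConv_apply]
    exact congr(($(map_mul (pairingHom D) x₁ x₂)).ofConv y)
  graft_left x y d := congr(($(pairingHom_graft d x)).ofConv y)

end Existence

namespace IsPairing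

variable {B : LinearMap.BilinForm ℚ (HPR D)}

theorem eq {B' : LinearMap.BilinForm ℚ (HPR D)} (h : IsPairing B) (h' : IsPairing B') :
    B = B' := by
  refine LinearMap.ext fun x => ?_
  induction x using graft_induction with
  | one => ext y; rw [h.one_left, h'.one_left]
  | add x y hx hy => rw [map_add, map_add, hx, hy]
  | smul r x hx => rw [map_smul, map_smul, hx]
  | mul x y hx hy =>
    apply toConv_injective
    rw [toConv_apply_mul h.mul_left, toConv_apply_mul h'.mul_left, hx, hy]
  | graft d x hx => ext y; rw [h.graft_left, h'.graft_left, hx]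

theorem one_right (h : IsPairing B) (x : HPR D) : B x 1 = counit (R := ℚ) x := by
  induction x using graft_induction with
  | one => exact h.one_left 1
  | add x y hx hy => simp [hx, hy]
  | smul r x hx => simp [hx]
  | mul x y hx hy => simp [h.mul_left, Algebra.TensorProduct.one_def, hx, hy, mul_comm]
  | graft d x _ => rw [h.graft_left, cutLast_one, map_zero, counit_graft]

theorem graft_right_graft (h : IsPairing B) (d d' : D) (x y : HPR D) :
    B (graft d' x) (graft d y) = B (cutLast d (graft d' x)) y := by
  rw [h.graft_left]
  by_cases hd : d' = d
  · subst hd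
    simp [cutLast_graft_self, Algebra.algebraMap_eq_smul_one, h.one_left, h.one_right, mul_comm]
  · simp [cutLast_graft_of_ne hd, cutLast_graft_of_ne (Ne.symm hd)]

theorem graft_right_of_mul (h : IsPairing B) {d : D} {x₁ x₂ : HPR D}
    (h₁ : ∀ y, B x₁ (graft d y) = B (cutLast d x₁) y)
    (h₂ : ∀ y, B x₂ (graft d y) = B (cutLast d x₂) y) (y : HPR D) :
    B (x₁ * x₂) (graft d y) = B (cutLast d (x₁ * x₂)) y := by
  have tmul_lTensor_graft (z : HPR D ⊗[ℚ] HPR D) :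
      B.tmul B (x₁ ⊗ₜ[ℚ] x₂) ((graft d).lTensor _ z) = B.tmul B (x₁ ⊗ₜ[ℚ] cutLast d x₂) z := by
    induction z with
    | zero => simp
    | add a b ha hb => simp only [map_add, ha, hb]
    | tmul a b => simp [h₂]
  rw [h.mul_left, comul_graft, map_add, tmul_lTensor_graft, ← h.mul_left, cutLast_mul, map_add,
    add_comm]
  simp [h₁, h.one_right]

theorem graft_right (h : IsPairing B) (x y : HPR D) (d : D) :
    B x (graft d y) = B (cutLast d x) y := by
  induction x using graft_induction generalizing y with
  | one => rw [h.one_left, counit_graft, cutLast_one, map_zero, LinearMap.zero_apply]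
  | add x y hx hy => simp [hx, hy]
  | smul r x hx => simp [hx]
  | mul x y hx hy => exact h.graft_right_of_mul hx hy _
  | graft d x _ => exact h.graft_right_graft ..

theorem mul_right_graft (h : IsPairing B) {x : HPR D}
    (hx : ∀ y₁ y₂, B x (y₁ * y₂) = B.tmul B (comul (R := ℚ) x) (y₁ ⊗ₜ[ℚ] y₂)) (d : D)
    (y₁ y₂ : HPR D) :
    B (graft d x) (y₁ * y₂) = B.tmul B (comul (R := ℚ) (graft d x)) (y₁ ⊗ₜ[ℚ] y₂) := by
  have tmul_lTensor_graft (z : HPR D ⊗[ℚ] HPR D) :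
      B.tmul B ((graft d).lTensor _ z) (y₁ ⊗ₜ[ℚ] y₂) = B.tmul B z (y₁ ⊗ₜ[ℚ] cutLast d y₂) := by
    induction z with
    | zero => simp
    | add a b ha hb => simp only [map_add, LinearMap.add_apply, ha, hb]
    | tmul a b => simp [h.graft_left]
  rw [h.graft_left, cutLast_mul, map_add, hx, comul_graft, map_add, LinearMap.add_apply,
    tmul_lTensor_graft, add_comm]
  simp [h.one_left, h.graft_left]

theorem mul_right (h : IsPairing B) (x y₁ y₂ : HPR D) :
    B x (y₁ * y₂) = B.tmul B (comul (R := ℚ) x) (y₁ ⊗ₜ[ℚ] y₂) := by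
  induction x using graft_induction generalizing y₁ y₂ with
  | one => simp [h.one_left, Algebra.TensorProduct.one_def, mul_comm]
  | add x y hx hy => simp only [map_add, LinearMap.add_apply, hx, hy]
  | smul r x hx => simp only [map_smul, LinearMap.smul_apply, hx]
  | mul x y hx hy => exact mul_right_of_mul h.mul_left hx hy y₁ y₂
  | graft d x hx => exact h.mul_right_graft hx d y₁ y₂

theorem isHopfPairing (h : IsPairing B) : IsHopfPairing B where
  one_left := h.one_left
  one_right := h.one_right
  mul_left := h.mul_left
  mul_right := h.mul_right

theorem flip (h : IsPairing B) : IsPairing (LinearMap.flip B) where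
  one_left := h.one_right
  mul_left x₁ x₂ y := (h.mul_right y x₁ x₂).trans (bilinForm_tmul_flip B _ _).symm
  graft_left x y d := h.graft_right y x d

theorem symm (h : IsPairing B) (x y : HPR D) : B x y = B y x :=
  LinearMap.congr_fun₂ (h.eq h.flip) x y

theorem exists_cut_of_mul_apply_mono_ne_zero (h : IsPairing B) {x y : HPR D} {G : PForest D}
    (hG : B (x * y) (mono G) ≠ 0) :
    ∃ c ∈ cuts G, B x (mono (forestPruned c)) ≠ 0 ∧ B y (mono (forestTrunk c)) ≠ 0 := by
  contrapose! hG
  rw [h.mul_left, comul_mono, map_list_sum, List.map_map]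
  refine List.sum_eq_zero fun r hr => ?_
  obtain ⟨c, hc, rfl⟩ := List.mem_map.1 hr
  simpa [or_iff_not_imp_right, not_imp_comm] using hG c hc

theorem decorations_eq_of_apply_mono_ne_zero (h : IsPairing B) {F G : PForest D}
    (hFG : B (mono F) (mono G) ≠ 0) : decorations F = decorations G := by
  induction F using forest_induction generalizing G with
  | nil =>
    rw [mono_nil, h.one_left, counit_mono] at hFG
    cases G with
    | nil => rfl
    | cons t G => exact absurd rfl hFG
  | cons d F F' hF hF' =>
    rw [mono_cons, ← mono_singleton, ← graft_mono] at hFG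
    obtain ⟨c, hc, hpruned, htrunk⟩ := h.exists_cut_of_mul_apply_mono_ne_zero hFG
    rw [h.graft_left] at hpruned
    obtain ⟨P, hP, hcut⟩ := exists_eq_concat_of_cutLast_mono_ne_zero
      fun h0 => hpruned (by rw [h0, map_zero])
    rw [hcut] at hpruned
    rw [← decorations_cut hc, hP, decorations_append, ← hF hpruned, ← hF' htrunk]
    simp [decorations, ← Multiset.singleton_add, add_left_comm, add_assoc]

theorem eq_zero_of_ne (h : IsPairing B) {m n : ℕ} {x y : HPR D} (hx : x ∈ homogeneous D m)
    (hy : y ∈ homogeneous D n) (hmn : m ≠ n) : B x y = 0 := by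
  induction hx, hy using Submodule.span_induction₂ with
  | zero_left => simp
  | zero_right => simp
  | add_left _ _ _ _ _ _ h₁ h₂ => simp [h₁, h₂]
  | add_right _ _ _ _ _ _ h₁ h₂ => simp [h₁, h₂]
  | smul_left _ _ _ _ _ h₁ => simp [h₁]
  | smul_right _ _ _ _ _ h₁ => simp [h₁]
  | mem_mem x y hx hy =>
    obtain ⟨F, rfl, rfl⟩ := hx
    obtain ⟨G, rfl, rfl⟩ := hy
    by_contra hFG
    refine hmn ?_
    rw [← card_decorations, ← card_decorations, h.decorations_eq_of_apply_mono_ne_zero hFG]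

theorem finite_support (h : IsPairing B) (x : HPR D) : {G | B x (mono G) ≠ 0}.Finite := by
  induction (forestBasis D).mem_span x using Submodule.span_induction with
  | zero => simp
  | add x y _ _ hx hy =>
    refine (hx.union hy).subset fun G hG => ?_
    contrapose! hG
    simp_all
  | smul r x _ hx => exact hx.subset fun G hG h0 => hG (by simp [h0])
  | mem x hx =>
    obtain ⟨F, rfl⟩ := hx
    refine (finite_decorations_eq (decorations F)).subset fun G hG => ?_
    exact (h.decorations_eq_of_apply_mono_ne_zero (by rwa [forestBasis_apply] at hG)).symm

theorem graft_apply_mul_graft (h : IsPairing B) (d : D) (v x y : HPR D) :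
    B (graft d v) (x * graft d y) = B v x * counit (R := ℚ) y := by
  rw [h.graft_left, cutLast_mul, counit_graft, zero_smul, add_zero, cutLast_graft_self,
    ← Algebra.commutes, ← Algebra.smul_def, map_smul, smul_eq_mul, mul_comm]

theorem graft_apply_mul_graft_of_ne (h : IsPairing B) {d d' : D} (hd : d' ≠ d) (v x y : HPR D) :
    B (graft d v) (x * graft d' y) = 0 := by
  rw [h.graft_left, cutLast_mul, counit_graft, zero_smul, add_zero, cutLast_graft_of_ne hd,
    mul_zero, map_zero]

theorem tmul_graft_mul_lTensor_graft (h : IsPairing B) (d : D) (u v y : HPR D)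
    (z : HPR D ⊗[ℚ] HPR D) :
    B.tmul B (u ⊗ₜ[ℚ] graft d v) (z * (graft d).lTensor _ (comul (R := ℚ) y)) =
      B.tmul B (u ⊗ₜ[ℚ] v) (z * (y ⊗ₜ[ℚ] 1)) := by
  induction z with
  | zero => simp
  | add a b ha hb => simp only [add_mul, map_add, ha, hb]
  | tmul a b =>
    calc B.tmul B (u ⊗ₜ[ℚ] graft d v) (a ⊗ₜ b * (graft d).lTensor _ (comul (R := ℚ) y))
        = B u (a * ∑ i ∈ (ℛ ℚ y).index, counit (R := ℚ) ((ℛ ℚ y).right i) • (ℛ ℚ y).left i) *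
            B v b := by
          rw [← (ℛ ℚ y).eq]
          simp [Finset.mul_sum, h.graft_apply_mul_graft, mul_comm, mul_left_comm]
      _ = B.tmul B (u ⊗ₜ[ℚ] v) (a ⊗ₜ b * (y ⊗ₜ[ℚ] 1)) := by
          rw [sum_counit_right_smul_left]
          simp [mul_comm]

theorem tmul_graft_mul_lTensor_graft_of_ne (h : IsPairing B) {d d' : D} (hd : d' ≠ d)
    (u v : HPR D) (z w : HPR D ⊗[ℚ] HPR D) :
    B.tmul B (u ⊗ₜ[ℚ] graft d v) (z * (graft d').lTensor _ w) = 0 := by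
  induction z with
  | zero => simp
  | add a b ha hb => simp only [add_mul, map_add, ha, hb, add_zero]
  | tmul a b =>
    induction w with
    | zero => simp
    | add w₁ w₂ h₁ h₂ => simp only [mul_add, map_add, h₁, h₂, add_zero]
    | tmul w₁ w₂ => simp [h.graft_apply_mul_graft_of_ne hd]

theorem mul_graft_apply_mono_concat (h : IsPairing B) {T G H K : PForest D} {d d' : D}
    {u v : HPR D} (hu : B u = (forestBasis D).coord G) (hv : B v = (forestBasis D).coord T)
    (hK : forestWeight G ≤ forestWeight K) :
    B (u * graft d v) (mono (H ++ [node d' K])) =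
      (forestBasis D).coord (T ++ [node d G]) (mono (H ++ [node d' K])) := by
  classical
  have apply_mul_graft (x : HPR D) : B u (x * graft d' (mono K)) = 0 * counit (R := ℚ) x := by
    have weight_lt : forestWeight G < forestWeight [node d' K] := by
      simp only [forestWeight, weight]; omega
    rw [graft_mono, hu, coord_mul_mono weight_lt.le, if_neg (by rintro rfl; exact weight_lt.false)]
  have apply_mul_mono (x : HPR D) : B u (x * mono K) = (if K = G then 1 else 0) * counit x := by
    rw [hu, coord_mul_mono hK]
  rw [mono_append, ← graft_mono, h.mul_left, Bialgebra.comul_mul, comul_graft, mul_add, map_add,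
    tmul_mul_tmul_one_of_apply_mul B apply_mul_graft, zero_mul, zero_add, graft_mono,
    ← mono_append, coord_mono]
  by_cases hd : d' = d
  · subst hd
    rw [h.tmul_graft_mul_lTensor_graft, tmul_mul_tmul_one_of_apply_mul B apply_mul_mono, hv,
      coord_mono, ite_mul, one_mul, zero_mul, ← ite_and]
    exact if_congr (by simp [eq_comm, and_comm]) rfl rfl
  · rw [h.tmul_graft_mul_lTensor_graft_of_ne hd, if_neg]
    simp [Ne.symm hd]

theorem coord_concat_mem_map_homogeneous (h : IsPairing B) (T : PForest D) (d : D) (G : PForest D)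
    (hG : (forestBasis D).coord G ∈ (homogeneous D (forestWeight G)).map B)
    (hT : (forestBasis D).coord T ∈ (homogeneous D (forestWeight T)).map B)
    (ih : ∀ H d' K, forestWeight (H ++ [node d' K]) = forestWeight (T ++ [node d G]) →
      forestWeight K < forestWeight G → (forestBasis D).coord (H ++ [node d' K]) ∈
        (homogeneous D (forestWeight (T ++ [node d G]))).map B) :
    (forestBasis D).coord (T ++ [node d G]) ∈
      (homogeneous D (forestWeight (T ++ [node d G]))).map B := by
  classical
  obtain ⟨u, hu, hBu⟩ := hG
  obtain ⟨v, hv, hBv⟩ := hT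
  set F := T ++ [node d G] with hF
  have weight_eq : forestWeight G + (forestWeight T + 1) = forestWeight F := by
    simp only [hF, forestWeight_append, forestWeight, weight]; omega
  have product_mem : u * graft d v ∈ homogeneous D (forestWeight F) :=
    weight_eq ▸ mul_mem_homogeneous hu (graft_mem_homogeneous hv d)
  have apply_of_weight_ne {A : PForest D} (hA : forestWeight A ≠ forestWeight F) :
      B (u * graft d v) (mono A) = (forestBasis D).coord F (mono A) := by
    rw [h.eq_zero_of_ne product_mem (mono_mem_homogeneous A) hA.symm, coord_mono, if_neg]
    rintro rfl
    exact hA rfl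
  have error_mem : B (u * graft d v) - (forestBasis D).coord F ∈
      (homogeneous D (forestWeight F)).map B := by
    refine functional_mem_of_coord_mem (forestBasis D)
      (((h.finite_support (u * graft d v)).union (Set.finite_singleton F)).subset fun A hA => ?_)
      fun A hA => ?_
    · contrapose! hA
      obtain ⟨hne, hA⟩ : A ≠ F ∧ B (u * graft d v) (mono A) = 0 := by simpa using hA
      simp [forestBasis_apply, hA, coord_mono, hne.symm, -Module.Basis.coord_apply]
    · rw [forestBasis_apply, LinearMap.sub_apply, sub_ne_zero] at hA
      have hweight : forestWeight A = forestWeight F := by_contra fun hne =>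
        hA (apply_of_weight_ne hne)
      rcases List.eq_nil_or_concat A with rfl | ⟨H, ⟨d', K⟩, rfl⟩
      · simp only [forestWeight] at hweight; omega
      · rw [List.concat_eq_append] at *
        exact ih H d' K hweight (not_le.1 fun hK => hA (h.mul_graft_apply_mono_concat hBu hBv hK))
  simpa using sub_mem (Submodule.mem_map_of_mem product_mem) error_mem

theorem coord_mem_map_homogeneous (h : IsPairing B) (F : PForest D) :
    (forestBasis D).coord F ∈ (homogeneous D (forestWeight F)).map B := by
  induction hn : forestWeight F using Nat.strong_induction_on generalizing F with
  | _ n ih =>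
    subst hn
    rcases List.eq_nil_or_concat F with rfl | ⟨T, ⟨d, G⟩, rfl⟩
    · exact ⟨1, mono_mem_homogeneous [], by rw [coord_nil]; exact LinearMap.ext h.one_left⟩
    rw [List.concat_eq_append] at ih ⊢
    induction hm : forestWeight G using Nat.strong_induction_on generalizing T d G with
    | _ m ih' =>
      subst hm
      have weight_eq : forestWeight (T ++ [node d G]) = forestWeight T + forestWeight G + 1 := by
        simp [forestWeight_append, forestWeight, weight, add_assoc]
      refine h.coord_concat_mem_map_homogeneous T d G (ih _ (by omega) G rfl)
        (ih _ (by omega) T rfl) fun H d' K hw hK => ?_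
      rw [← hw]
      exact ih' _ hK H d' K (by rwa [hw]) rfl

theorem injective (h : IsPairing B) : Function.Injective B := by
  refine (injective_iff_map_eq_zero B).2 fun x hx => (forestBasis D).ext_elem fun F => ?_
  obtain ⟨y, -, hy⟩ := h.coord_mem_map_homogeneous F
  rw [← Module.Basis.coord_apply, ← hy, h.symm, hx]
  simp

theorem nondegenerate (h : IsPairing B) : B.Nondegenerate :=
  ⟨fun x hx => h.injective (LinearMap.ext fun y => by simpa using hx y),
    fun y hy => h.injective (LinearMap.ext fun x => by simpa [h.symm y x] using hy x)⟩

/-- The element `e_F` with `(e_F, G) = δ_{F,G}` for every forest `G`. -/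
noncomputable def dualElement (h : IsPairing B) (F : PForest D) : HPR D :=
  (h.coord_mem_map_homogeneous F).choose

theorem dualElement_mem_homogeneous (h : IsPairing B) (F : PForest D) :
    h.dualElement F ∈ homogeneous D (forestWeight F) :=
  (h.coord_mem_map_homogeneous F).choose_spec.1

theorem apply_dualElement (h : IsPairing B) (F : PForest D) :
    B (h.dualElement F) = (forestBasis D).coord F :=
  (h.coord_mem_map_homogeneous F).choose_spec.2

theorem linearIndependent_dualElement (h : IsPairing B) : LinearIndependent ℚ h.dualElement := by
  refine LinearIndependent.of_comp B ?_
  rw [show B ∘ h.dualElement = (forestBasis D).coord from funext h.apply_dualElement]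
  exact (forestBasis D).linearIndependent_coord

theorem mem_span_range_dualElement (h : IsPairing B) (x : HPR D) :
    x ∈ Submodule.span ℚ (Set.range h.dualElement) := by
  have apply_mem : B x ∈ (Submodule.span ℚ (Set.range h.dualElement)).map B := by
    refine functional_mem_of_coord_mem (forestBasis D)
      (by simpa only [forestBasis_apply] using h.finite_support x) fun F _ => ?_
    rw [← h.apply_dualElement]
    exact Submodule.mem_map_of_mem (Submodule.subset_span ⟨F, rfl⟩)
  obtain ⟨y, hy, hyx⟩ := apply_mem
  rwa [← h.injective hyx]

/-- The basis `(e_F)` dual to the basis of forests. -/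
noncomputable def dualBasis (h : IsPairing B) : Module.Basis (PForest D) ℚ (HPR D) :=
  .mk h.linearIndependent_dualElement fun x _ => h.mem_span_range_dualElement x

theorem dualBasis_mem_homogeneous (h : IsPairing B) (F : PForest D) :
    h.dualBasis F ∈ homogeneous D (forestWeight F) := by
  rw [dualBasis, Module.Basis.mk_apply]
  exact h.dualElement_mem_homogeneous F

theorem apply_dualBasis (h : IsPairing B) (F : PForest D) :
    B (h.dualBasis F) = (forestBasis D).coord F := by
  rw [dualBasis, Module.Basis.mk_apply, h.apply_dualElement]

theorem isDualFamily_iff (h : IsPairing B) (e : PForest D → HPR D) :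
    IsDualFamily B e ↔ e = h.dualBasis := by
  constructor
  · refine fun he => funext fun F => h.injective ((forestBasis D).ext fun G => ?_)
    rw [h.apply_dualBasis, forestBasis_apply, he F G, coord_mono]
  · rintro rfl F G
    rw [h.apply_dualBasis, coord_mono]

theorem dualBasis_repr (h : IsPairing B) (x : HPR D) (F : PForest D) :
    h.dualBasis.repr x F = B x (mono F) := by
  classical
  have coord_eq : h.dualBasis.coord F = LinearMap.flip B (mono F) := by
    refine h.dualBasis.ext fun G => ?_
    rw [coord_apply_basis, LinearMap.flip_apply, h.apply_dualBasis, coord_mono]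
    exact if_congr eq_comm rfl rfl
  exact LinearMap.congr_fun coord_eq x

theorem dualBasis_tensorProduct_repr (h : IsPairing B) (z : HPR D ⊗[ℚ] HPR D) (F G : PForest D) :
    (h.dualBasis.tensorProduct h.dualBasis).repr z (F, G) =
      B.tmul B z (mono F ⊗ₜ[ℚ] mono G) := by
  induction z with
  | zero => simp
  | add a b ha hb => simp [ha, hb]
  | tmul a b => simp [h.dualBasis_repr, mul_comm]

theorem comul_dualBasis (h : IsPairing B) (F : PForest D) :
    comul (R := ℚ) (h.dualBasis F) = ∑ i ∈ Finset.range (F.length + 1),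
      h.dualBasis (F.take i) ⊗ₜ[ℚ] h.dualBasis (F.drop i) := by
  classical
  refine (h.dualBasis.tensorProduct h.dualBasis).ext_elem fun ⟨G, K⟩ => ?_
  rw [h.dualBasis_tensorProduct_repr, h.dualBasis_tensorProduct_repr, ← h.mul_right, ← mono_append,
    h.apply_dualBasis, coord_mono]
  simp only [map_sum, LinearMap.sum_apply, LinearMap.BilinForm.tensorDistrib_tmul,
    h.apply_dualBasis, coord_mono, smul_eq_mul, mul_ite, mul_one, mul_zero, ← ite_and]
  rw [sum_range_take_drop]

theorem dualBasis_nil (h : IsPairing B) : h.dualBasis [] = 1 :=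
  h.injective (LinearMap.ext fun y => by rw [h.apply_dualBasis, coord_nil, h.one_left])

theorem dualBasis_singleton_mem_primitives (h : IsPairing B) (t : PTree D) :
    h.dualBasis [t] ∈ primitives D := by
  change comul (R := ℚ) _ = _
  simp [h.comul_dualBasis, Finset.sum_range_succ, h.dualBasis_nil, add_comm]

theorem span_dualBasis_singleton (h : IsPairing B) :
    Submodule.span ℚ (Set.range fun t : PTree D => h.dualBasis [t]) = primitives D := by
  refine le_antisymm (Submodule.span_le.2 ?_) fun x hx => ?_
  · rintro _ ⟨t, rfl⟩
    exact h.dualBasis_singleton_mem_primitives t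
  have apply_mul (y₁ y₂ : HPR D) := h.isHopfPairing.apply_mul_of_comul_eq hx y₁ y₂
  rw [← h.dualBasis.linearCombination_repr x, Finsupp.linearCombination_apply]
  refine sum_mem fun F hF => Submodule.smul_mem _ _ ?_
  rw [Finsupp.mem_support_iff, h.dualBasis_repr] at hF
  match F, hF with
  | [], hF => exact absurd (by simpa [mono_nil] using apply_mul 1 1) hF
  | [t], _ => exact Submodule.subset_span ⟨t, rfl⟩
  | t :: t' :: F, hF =>
    refine absurd ?_ hF
    rw [mono_cons, ← mono_singleton, apply_mul, counit_mono, counit_mono]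
    simp

/-- The basis of the primitive elements formed by the dual elements of the trees. -/
noncomputable def primitiveBasis (h : IsPairing B) : Module.Basis (PTree D) ℚ (primitives D) :=
  (Module.Basis.span (h.dualBasis.linearIndependent.comp _ List.singleton_injective)).map
    (LinearEquiv.ofEq _ _ h.span_dualBasis_singleton)

theorem coe_primitiveBasis (h : IsPairing B) (t : PTree D) :
    (h.primitiveBasis t : HPR D) = h.dualBasis [t] := by
  rw [primitiveBasis, Module.Basis.map_apply, LinearEquiv.coe_ofEq_apply, Module.Basis.span_apply]
  rfl

end IsPairing

end HPR

theorem mainTheorem4 (D : Type*) :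
    (∃! B : LinearMap.BilinForm ℚ (HPR D), HPR.IsPairing B) ∧
    ∀ B : LinearMap.BilinForm ℚ (HPR D), HPR.IsPairing B →
      (∀ (m n : ℕ) (x y : HPR D), x ∈ HPR.homogeneous D m → y ∈ HPR.homogeneous D n → m ≠ n →
        B x y = 0) ∧
      B.IsSymm ∧
      B.Nondegenerate ∧
      (∀ x y : HPR D, B (HopfAlgebra.antipode ℚ x) y = B x (HopfAlgebra.antipode ℚ y)) ∧
      ∃ e : Module.Basis (PForest D) ℚ (HPR D),
        (∀ e' : PForest D → HPR D, HPR.IsDualFamily B e' ↔ e' = e) ∧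
        (∀ F : PForest D, e F ∈ HPR.homogeneous D (PTree.forestWeight F)) ∧
        (∃ b : Module.Basis (PTree D) ℚ (HPR.primitives D), ∀ t : PTree D, (b t : HPR D) = e [t]) ∧
        ∀ F : PForest D, Coalgebra.comul (R := ℚ) (e F) =
          ∑ i ∈ Finset.range (F.length + 1), e (F.take i) ⊗ₜ[ℚ] e (F.drop i) := by
  refine ⟨⟨HPR.pairing D, HPR.isPairing_pairing, fun B h => h.eq HPR.isPairing_pairing⟩,
    fun B h => ⟨fun m n x y => h.eq_zero_of_ne, ⟨h.symm⟩, h.nondegenerate,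
      h.isHopfPairing.antipode_left, h.dualBasis, h.isDualFamily_iff, h.dualBasis_mem_homogeneous,
      ⟨h.primitiveBasis, h.coe_primitiveBasis⟩, h.comul_dualBasis⟩⟩
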